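/- All graphs are simple, undirected, and possibly infinite. The \emph{radius} of a connected graph $H$ is $\min_{v\in V(H)}\sup_{w\in V(H)}\mathrm{dist}_H(v,w)$ (a disconnected graph has infinite radius). The \emph{growth} of a graph $G$ is the function $f_G:\{1,2,3,\dots\}\to\mathbb{N}\cup\{\infty\}$ where $f_G(r)$ is the supremum of $|V(H)|$ over all subgraphs $H$ of $G$ with radius at most $r$. The \emph{strong product} $G\boxtimes H$ is the graph with vertex set $V(G)\times V(H)$ in which $(v,w)$ and $(v',w')$ are adjacent if and only if $vv'\in E(G)$ and ($w=w'$ or $ww'\in E(H)$), or $v=v'$ and $ww'\in E(H)$. $K_t$ denotes the complete graph on $t$ vertices. \textbf{Theorem.} For every real number $c\ge 1$, every graph $G$ with growth $f_G(r)\le cr$ for all integers $r\ge 1$ is isomorphic to a subgraph of $T\boxtimes K_{\lfloor 882c^3\rfloor}$ for some tree $T$. -/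

import Mathlib

universe u v

/-- The growth of a (possibly infinite) graph `G`: `G.growth r` is the supremum of `|V(H)|` over all
subgraphs `H` of `G` with radius at most `r`. A disconnected graph has infinite radius. -/
noncomputable def SimpleGraph.growth {V : Type u} (G : SimpleGraph V) (r : ℕ) : ℕ∞ :=
  ⨆ (H : G.Subgraph) (_ : H.coe.radius ≤ (r : ℕ∞)), H.verts.encard

/-- The strong product of two graphs. -/
def SimpleGraph.strongProduct {V : Type u} {W : Type v} (G : SimpleGraph V) (H : SimpleGraph W) :
    SimpleGraph (V × W) where
  Adj p q := (G.Adj p.1 q.1 ∧ (p.2 = q.2 ∨ H.Adj p.2 q.2)) ∨ (p.1 = q.1 ∧ H.Adj p.2 q.2)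
  symm := ⟨fun p q h => by
    rcases h with ⟨h1, h2 | h2⟩ | ⟨h1, h2⟩
    · exact Or.inl ⟨h1.symm, Or.inl h2.symm⟩
    · exact Or.inl ⟨h1.symm, Or.inr h2.symm⟩
    · exact Or.inr ⟨h1.symm, h2.symm⟩⟩
  loopless := ⟨fun p h => by
    rcases h with ⟨h1, -⟩ | ⟨-, h2⟩
    · exact G.loopless.irrefl _ h1
    · exact H.loopless.irrefl _ h2⟩

/-! Put `k = ⌈c⌉`, so balls of radius `r ≥ 1` have at most `k * r` vertices. Exhaust the vertices by
sets `R n`, each containing the neighbours of the last and at most `44 * k ^ 3` new vertices in each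
component of `G - R n`. The components of all `G - R n`, ordered by inclusion, form a tree; sending
each vertex to the component in which it is absorbed maps edges to nodes or tree edges, with small
fibres.

To keep going, each component must have at most `22 * k ^ 3` vertices next to `R n`. This rests on
`BallBound.exists_attachment_le`: a finite `S` at most doubles to a set whose complementary
components each attach to `O(k ^ 2)` of its vertices. If a ball is rich in `S`, take one of least
radius `r`. Linear growth gives a sphere of size at most `2 * k` at radius between `r` and `2 * r`,
and a packing argument bounds the part of `S` inside. Cut along the sphere and recurse outside; the
elements of `S` enclosed pay for the sphere. -/

namespace SimpleGraph

variable {V : Type u}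

/-! ### Balls under linear growth -/

/-- The set of vertices that can be reached from `v` in at most `n` steps. -/
def closedBall (H : SimpleGraph V) (v : V) : ℕ → Set V
  | 0 => {v}
  | n + 1 => H.closedBall v n ∪ {w | ∃ u ∈ H.closedBall v n, H.Adj u w}

/-- The graph obtained from `H` by deleting all edges with an end in `R`. -/
def isolate (H : SimpleGraph V) (R : Set V) : SimpleGraph V where
  Adj x y := H.Adj x y ∧ x ∉ R ∧ y ∉ R
  symm := ⟨fun _ _ h => ⟨h.1.symm, h.2.2, h.2.1⟩⟩
  loopless := ⟨fun _ h => H.loopless.irrefl _ h.1⟩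

/-- Balls of radius `r ≥ 1` have at most `k * r` vertices. -/
def BallBound (H : SimpleGraph V) (k : ℕ) : Prop :=
  ∀ v r, 1 ≤ r → (H.closedBall v r).encard ≤ (k * r : ℕ)

lemma isolate_le (H : SimpleGraph V) (R : Set V) : H.isolate R ≤ H := fun _ _ h => h.1

lemma isolate_anti (H : SimpleGraph V) {R R' : Set V} (h : R ⊆ R') :
    H.isolate R' ≤ H.isolate R := fun _ _ a => ⟨a.1, fun b => a.2.1 (h b), fun b => a.2.2 (h b)⟩

variable {H : SimpleGraph V} {k : ℕ}

lemma mem_closedBall_self (v : V) (n : ℕ) : v ∈ H.closedBall v n := by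
  induction n with
  | zero => rfl
  | succ n ih => exact Or.inl ih

lemma closedBall_mono (v : V) : Monotone (H.closedBall v) :=
  monotone_nat_of_le_succ fun _ => Set.subset_union_left

lemma mem_closedBall_succ {v u w : V} {n : ℕ} (hu : u ∈ H.closedBall v n) (h : H.Adj u w) :
    w ∈ H.closedBall v (n + 1) := Or.inr ⟨u, hu, h⟩

lemma mem_closedBall_trans {u v w : V} {a b : ℕ} (hv : v ∈ H.closedBall u a)
    (hw : w ∈ H.closedBall v b) : w ∈ H.closedBall u (a + b) := by
  induction b generalizing w with
  | zero => obtain rfl : w = v := hw; exact hv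
  | succ b ih =>
    rcases hw with hw | ⟨x, hx, h⟩
    · exact Or.inl (ih hw)
    · exact Or.inr ⟨x, ih hx, h⟩

lemma mem_closedBall_symm {v w : V} {n : ℕ} (h : w ∈ H.closedBall v n) :
    v ∈ H.closedBall w n := by
  induction n generalizing w with
  | zero => exact Eq.symm h
  | succ n ih =>
    rcases h with h | ⟨x, hx, h⟩
    · exact closedBall_mono _ n.le_succ (ih h)
    · rw [add_comm]
      exact mem_closedBall_trans (mem_closedBall_succ (mem_closedBall_self w 0) h.symm) (ih hx)

lemma closedBall_subset_of_le {G : SimpleGraph V} (h : H ≤ G) (v : V) (n : ℕ) :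
    H.closedBall v n ⊆ G.closedBall v n := by
  induction n with
  | zero => exact subset_rfl
  | succ n ih =>
    rintro w (hw | ⟨x, hx, hxw⟩)
    · exact Or.inl (ih hw)
    · exact Or.inr ⟨x, ih hx, h hxw⟩

/-- A set that is closed under passing to neighbours is closed under reachability. -/
lemma Reachable.mem_of_closed {A : Set V} (hA : ∀ x ∈ A, ∀ y, H.Adj x y → y ∈ A) {v w : V}
    (h : H.Reachable v w) (hv : v ∈ A) : w ∈ A := by
  obtain ⟨p⟩ := h
  induction p with
  | nil => exact hv
  | cons a _ ih => exact ih (hA _ hv _ a)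

lemma Reachable.exists_mem_closedBall {v w : V} (h : H.Reachable v w) :
    ∃ n, w ∈ H.closedBall v n :=
  h.mem_of_closed (A := {w | ∃ n, w ∈ H.closedBall v n})
    (fun _ ⟨n, hn⟩ _ a => ⟨n + 1, mem_closedBall_succ hn a⟩) ⟨0, rfl⟩

lemma BallBound.mono {G : SimpleGraph V} (hG : G.BallBound k) (h : H ≤ G) : H.BallBound k :=
  fun v r hr => (Set.encard_le_encard (closedBall_subset_of_le h v r)).trans (hG v r hr)

lemma BallBound.ncard_le (hH : H.BallBound k) (v : V) {r : ℕ} (hr : 1 ≤ r) :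
    (H.closedBall v r).ncard ≤ k * r :=
  (Set.encard_le_coe_iff_finite_ncard_le.1 (hH v r hr)).2

lemma BallBound.finite (hH : H.BallBound k) (v : V) (r : ℕ) : (H.closedBall v r).Finite :=
  (Set.encard_le_coe_iff_finite_ncard_le.1 (hH v (r + 1) (by omega))).1.subset
    (closedBall_mono v r.le_succ)

lemma BallBound.encard_neighborSet_le (hH : H.BallBound k) (v : V) :
    (H.neighborSet v).encard ≤ k := by
  have h : H.neighborSet v ⊆ H.closedBall v 1 := fun w hw =>
    mem_closedBall_succ (mem_closedBall_self v 0) hw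
  simpa using (Set.encard_le_encard h).trans (hH v 1 le_rfl)

/-- A ball that contains few vertices is a whole component. -/
lemma BallBound.closedBall_subset_of_ncard_le (hH : H.BallBound k) {x : V} {n : ℕ}
    (h : (H.closedBall x n).ncard ≤ n) (m : ℕ) : H.closedBall x m ⊆ H.closedBall x n := by
  -- Otherwise the balls of radius 0 to `n` grow strictly and the last has at least `n + 1`
  -- vertices.
  obtain ⟨j, hj, hs⟩ : ∃ j < n, H.closedBall x (j + 1) ⊆ H.closedBall x j := by
    by_contra! hc
    have key : ∀ i ≤ n, i + 1 ≤ (H.closedBall x i).ncard := by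
      intro i
      induction i with
      | zero => simp [closedBall]
      | succ i ih =>
        intro hi
        have h1 := ih (by omega)
        have h2 := Set.ncard_lt_ncard ⟨closedBall_mono x i.le_succ, hc i (by omega)⟩
          (hH.finite x (i + 1))
        simp only [Nat.succ_eq_add_one] at h2
        omega
    have := key n le_rfl
    omega
  have hm : H.closedBall x m ⊆ H.closedBall x j := by
    induction m with
    | zero => rintro y rfl; exact mem_closedBall_self _ _
    | succ m ih =>
      rintro w (hw | ⟨y, hy, hyw⟩)
      · exact ih hw
      · exact hs (mem_closedBall_succ (ih hy) hyw)
  exact hm.trans (closedBall_mono x hj.le)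

/-- Among the spheres of radius in `[r + 1, 2 * r]` there is a small one. -/
lemma BallBound.exists_small_sphere (hH : H.BallBound k) (v : V) {r : ℕ} (hr : 1 ≤ r) :
    ∃ j, r ≤ j ∧ j + 1 ≤ 2 * r ∧
      (H.closedBall v (j + 1) \ H.closedBall v j).ncard ≤ 2 * k := by
  by_contra! hc
  have key : ∀ i ≤ r, i * (2 * k + 1) ≤ (H.closedBall v (r + i)).ncard := by
    intro i
    induction i with
    | zero => simp
    | succ i ih =>
      intro hi
      have h1 := ih (by omega)
      have h2 := hc (r + i) (by omega) (by omega)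
      have h3 := Set.ncard_sdiff_add_ncard_of_subset (closedBall_mono (H := H) v (r + i).le_succ)
        (hH.finite v _)
      simp only [Nat.succ_eq_add_one] at h3
      rw [← add_assoc, add_mul]
      omega
  have h1 := key r le_rfl
  have h2 := hH.ncard_le v (r := r + r) (by omega)
  nlinarith

open Classical in
/-- If all balls of radius less than `r` contain at most `m` elements of `S`, then balls of
radius `2 * r` contain at most `5 * k * m` elements of `S`. -/
lemma BallBound.card_filter_closedBall_le (hk : 1 ≤ k) (hH : H.BallBound k) (S : Finset V)
    {m r : ℕ} (hr : 1 ≤ r)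
    (hS : ∀ x, ∀ i < r, (S.filter (· ∈ H.closedBall x i)).card ≤ m) (v : V) :
    (S.filter (· ∈ H.closedBall v (2 * r))).card ≤ 5 * k * m := by
  -- Largest `ρ` with `2 * ρ < r`: doubled packing balls still satisfy `hS`.
  set ρ := (r - 1) / 2 with hρ
  have hfin := hH.finite v (2 * r)
  obtain ⟨P, hP, hmax⟩ := Finset.exists_max_image
    (hfin.toFinset.powerset.filter fun P : Finset V => (P : Set V).PairwiseDisjoint fun x => H.closedBall x ρ)
    Finset.card ⟨∅, by simp⟩
  simp only [Finset.mem_filter, Finset.mem_powerset] at hP hmax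
  obtain ⟨hPs, hPd⟩ := hP
  have hcov : ∀ x ∈ H.closedBall v (2 * r), ∃ p ∈ P, x ∈ H.closedBall p (ρ + ρ) := by
    intro x hx
    by_contra! hc
    have hd : ∀ p ∈ P, Disjoint (H.closedBall x ρ) (H.closedBall p ρ) := by
      intro p hp
      rw [Set.disjoint_left]
      intro y hy hy'
      exact hc p hp (mem_closedBall_trans hy' (mem_closedBall_symm hy))
    have hxP : x ∉ P := fun h => hc x h (mem_closedBall_self _ _)
    have := hmax (insert x P) ⟨by
      intro y hy
      rcases Finset.mem_insert.1 hy with rfl | hy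
      · simpa using hx
      · exact hPs hy, by
      rw [Finset.coe_insert]
      exact hPd.insert fun p hp _ => hd p hp⟩
    rw [Finset.card_insert_of_notMem hxP] at this
    omega
  -- A packing ball with at most `ρ` vertices is a whole component, hence contains the ball about
  -- `v`. Otherwise every packing ball has at least `ρ + 1` vertices, which bounds their number.
  by_cases hsm : ∃ p ∈ P, (H.closedBall p ρ).ncard ≤ ρ
  · obtain ⟨p, hp, hle⟩ := hsm
    have hvp : v ∈ H.closedBall p (2 * r) := mem_closedBall_symm (by simpa using hPs hp)
    calc _ ≤ (S.filter (· ∈ H.closedBall p ρ)).card := by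
          apply Finset.card_le_card
          intro x hx
          rw [Finset.mem_filter] at hx ⊢
          exact ⟨hx.1, hH.closedBall_subset_of_ncard_le hle _ (mem_closedBall_trans hvp hx.2)⟩
      _ ≤ m := hS p ρ (by omega)
      _ ≤ 5 * k * m := by nlinarith
  · push Not at hsm
    have hcard : P.card * (ρ + 1) ≤ k * (2 * r + ρ) := by
      calc P.card * (ρ + 1) ≤ ∑ p ∈ P, (hH.finite p ρ).toFinset.card := by
            rw [← smul_eq_mul]
            refine Finset.card_nsmul_le_sum _ _ _ fun p hp => ?_
            rw [← Set.ncard_eq_toFinset_card _ (hH.finite p ρ)]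
            exact hsm p hp
        _ = (P.biUnion fun p => (hH.finite p ρ).toFinset).card := by
            rw [Finset.card_biUnion]
            intro p hp q hq hpq
            refine Set.Finite.disjoint_toFinset.2 ?_
            exact hPd hp hq hpq
        _ ≤ (hH.finite v (2 * r + ρ)).toFinset.card := by
            apply Finset.card_le_card
            intro x hx
            simp only [Finset.mem_biUnion, Set.Finite.mem_toFinset] at hx ⊢
            obtain ⟨p, hp, hx⟩ := hx
            exact mem_closedBall_trans (by simpa using hPs hp) hx
        _ ≤ k * (2 * r + ρ) := by
            rw [← Set.ncard_eq_toFinset_card _ (hH.finite v _)]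
            exact hH.ncard_le v (by omega)
    have hP5 : P.card ≤ 5 * k := by
      have : P.card * (ρ + 1) ≤ 5 * k * (ρ + 1) := by
        calc _ ≤ k * (2 * r + ρ) := hcard
          _ ≤ k * (5 * (ρ + 1)) := Nat.mul_le_mul_left _ (by omega)
          _ = _ := by ring
      exact Nat.le_of_mul_le_mul_right this (by omega)
    calc _ ≤ (P.biUnion fun p => S.filter (· ∈ H.closedBall p (ρ + ρ))).card := by
          apply Finset.card_le_card
          intro x hx
          rw [Finset.mem_filter] at hx
          obtain ⟨p, hp, hxp⟩ := hcov x hx.2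
          simp only [Finset.mem_biUnion, Finset.mem_filter]
          exact ⟨p, hp, hx.1, hxp⟩
      _ ≤ P.card * m := Finset.card_biUnion_le_card_mul _ _ _ fun p _ => hS p _ (by omega)
      _ ≤ 5 * k * m := Nat.mul_le_mul_right _ hP5

end SimpleGraph

/-! ### Separators with small attachments -/

namespace SimpleGraph

variable {V : Type u} {H : SimpleGraph V} {k : ℕ}

lemma mem_of_reachable_isolate {R A : Set V} {v w : V} (h : (H.isolate R).Reachable v w)
    (hv : v ∈ A) (hA : ∀ x ∈ A, ∀ y ∉ R, H.Adj x y → y ∈ A) : w ∈ A :=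
  Reachable.mem_of_closed (H := H.isolate R) (fun x hx y a => hA x hx y a.2.2 a.1) h hv

/-- If a graph `K` has all those edges of `H.isolate R` that leave vertices of a set `A` containing
`v` and closed under adjacency in `H.isolate R`, then vertices reachable from `v` in `H.isolate R`
are reachable in `K`. -/
lemma reachable_of_closed {H K : SimpleGraph V} {A : Set V} {v w : V}
    (h : H.Reachable v w) (hv : v ∈ A) (hA : ∀ x ∈ A, ∀ y, H.Adj x y → K.Adj x y ∧ y ∈ A) :
    K.Reachable v w ∧ w ∈ A :=
  h.mem_of_closed (A := {w | K.Reachable v w ∧ w ∈ A})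
    (fun x hx y a => ⟨hx.1.trans (hA x hx.2 y a).1.reachable, (hA x hx.2 y a).2⟩)
    ⟨Reachable.refl v, hv⟩

/-- The vertices of `R` that have a neighbour in the component of `v` in `H - R`. -/
def attachment (H : SimpleGraph V) (R : Set V) (v : V) : Set V :=
  {y | y ∈ R ∧ ∃ x, (H.isolate R).Reachable v x ∧ H.Adj x y}

-- The attachment lies in the component of `v` in `H` and is finite, so one large ball about `v`
-- contains it.
open Classical in
lemma card_attachment_le_of_forall_ball (S : Finset V) {m : ℕ}
    (hS : ∀ x i, (S.filter (· ∈ H.closedBall x i)).card ≤ m) (v : V) :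
    (H.attachment S v).encard ≤ m := by
  have hY : H.attachment S v = (S.filter (· ∈ H.attachment S v) : Finset V) := by
    ext y
    simp only [Finset.coe_filter, Set.mem_ofPred_eq]
    exact ⟨fun h => ⟨h.1, h⟩, fun h => h.2⟩
  have hn : ∀ y : V, ∃ n, y ∈ H.attachment S v → y ∈ H.closedBall v n := by
    intro y
    by_cases hy : y ∈ H.attachment S v
    · obtain ⟨x, hx, hxy⟩ := hy.2
      obtain ⟨n, hn⟩ := ((hx.mono (isolate_le _ _)).trans hxy.reachable).exists_mem_closedBall
      exact ⟨n, fun _ => hn⟩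
    · exact ⟨0, fun h => absurd h hy⟩
  choose n hn using hn
  rw [hY, Set.encard_coe_eq_coe_finsetCard]
  refine Nat.cast_le.2 (le_trans (Finset.card_le_card ?_) (hS v (S.sup n)))
  intro y hy
  rw [Finset.mem_filter] at hy ⊢
  exact ⟨hy.1, closedBall_mono v (Finset.le_sup hy.1) (hn y hy.2)⟩

open Classical in
/-- If some ball contains many elements of `S`, then there is a finite set `I` (the interior)
containing many, but not too many elements of `S`, with few neighbours outside. -/
lemma BallBound.exists_interior (hk : 1 ≤ k) (hH : H.BallBound k) (S : Finset V)
    (hS : ∃ x i, 4 * k < (S.filter (· ∈ H.closedBall x i)).card) :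
    ∃ I L : Finset V, Disjoint I L ∧ (∀ x ∈ I, ∀ y, H.Adj x y → y ∈ I ∪ L) ∧
      4 * k < (S ∩ I).card ∧ (S ∩ I).card ≤ 20 * k ^ 2 ∧ L.card ≤ 2 * k := by
  have hex : ∃ i, ∃ x, 4 * k < (S.filter (· ∈ H.closedBall x i)).card := by
    obtain ⟨x, i, h⟩ := hS
    exact ⟨i, x, h⟩
  set r := Nat.find hex with hr
  obtain ⟨v, hv⟩ := Nat.find_spec hex
  rw [← hr] at hv
  have hmin : ∀ x, ∀ i < r, (S.filter (· ∈ H.closedBall x i)).card ≤ 4 * k := by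
    intro x i hi
    have := Nat.find_min hex hi
    push Not at this
    exact this x
  have hr1 : 1 ≤ r := by
    by_contra! h0
    have h0 : r = 0 := by omega
    rw [h0] at hv
    have : (S.filter (· ∈ H.closedBall v 0)).card ≤ ({v} : Finset V).card := by
      apply Finset.card_le_card
      intro x hx
      simpa [closedBall] using (Finset.mem_filter.1 hx).2
    simp only [Finset.card_singleton] at this
    omega
  obtain ⟨j, hj, hj2, hL⟩ := hH.exists_small_sphere v hr1
  have hSI : S ∩ (hH.finite v j).toFinset = S.filter (· ∈ H.closedBall v j) := by
    ext; simp
  refine ⟨(hH.finite v j).toFinset, ((hH.finite v (j + 1)).sdiff (t := H.closedBall v j)).toFinset,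
    ?_, ?_, ?_, ?_, ?_⟩
  · rw [Set.Finite.disjoint_toFinset]
    exact Set.disjoint_sdiff_right
  · intro x hx y a
    simp only [Set.Finite.mem_toFinset, Finset.mem_union, Set.mem_sdiff] at hx ⊢
    have := mem_closedBall_succ hx a
    tauto
  · rw [hSI]
    refine hv.trans_le (Finset.card_le_card ?_)
    exact Finset.monotone_filter_right _ fun x _ h => closedBall_mono v hj h
  · rw [hSI]
    calc _ ≤ (S.filter (· ∈ H.closedBall v (2 * r))).card :=
          Finset.card_le_card <|
            Finset.monotone_filter_right _ fun x _ h => closedBall_mono v (by omega) h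
      _ ≤ 5 * k * (4 * k) := hH.card_filter_closedBall_le hk S hr1 hmin v
      _ = 20 * k ^ 2 := by ring
  · rwa [← Set.ncard_eq_toFinset_card _ ((hH.finite v (j + 1)).sdiff)]

open Classical in
/-- A finite set `S` extends to a set `R` of at most twice the size, such that every component of
`H - R` has a bounded number of neighbours in `R`. -/
theorem BallBound.exists_attachment_le (hk : 1 ≤ k) (hH : H.BallBound k) (S : Finset V) :
    ∃ R : Finset V, S ⊆ R ∧ R.card ≤ 2 * S.card ∧
      ∀ v ∉ R, (H.attachment R v).encard ≤ (22 * k ^ 2 : ℕ) := by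
  induction hn : S.card using Nat.strong_induction_on generalizing H S with
  | _ n ih =>
  subst hn
  by_cases hS : ∃ x i, 4 * k < (S.filter (· ∈ H.closedBall x i)).card
  swap
  · push Not at hS
    refine ⟨S, subset_rfl, by omega, fun v _ => ?_⟩
    exact (card_attachment_le_of_forall_ball S hS v).trans (Nat.cast_le.2 (by nlinarith))
  obtain ⟨I, L, hIL, hadj, hlow, hup, hLc⟩ := hH.exists_interior hk S hS
  have hsplit : (S \ I).card + (S ∩ I).card = S.card := Finset.card_sdiff_add_card_inter S I
  -- More than `4 * k` elements leave and at most `2 * k` enter, so the size drops. The gain,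
  -- doubled by induction, also pays for putting `S ∩ I` back.
  have hc1 : (S \ I ∪ L).card ≤ (S \ I).card + L.card := Finset.card_union_le _ _
  obtain ⟨R', hSR, hRc, hR⟩ := ih (S \ I ∪ L).card (by omega)
    (hH.mono (isolate_le H I)) (S \ I ∪ L) rfl
  have hLR : L ⊆ R' := Finset.subset_union_right.trans hSR
  have hSIR : S \ I ⊆ R' := Finset.subset_union_left.trans hSR
  have hLI : ∀ x ∈ L, x ∈ S ∪ R' \ I := fun x hx => Finset.mem_union_right _
    (Finset.mem_sdiff.2 ⟨hLR hx, fun h => Finset.disjoint_left.1 hIL h hx⟩)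
  have hunion : S ∪ R' \ I ⊆ (S ∩ I) ∪ R' := by
    intro x hx
    have := @hSIR x
    simp only [Finset.mem_union, Finset.mem_inter, Finset.mem_sdiff] at hx this ⊢
    tauto
  have hcard := (Finset.card_le_card hunion).trans (Finset.card_union_le _ _)
  refine ⟨S ∪ R' \ I, Finset.subset_union_left, by omega, fun v hv => ?_⟩
  -- `L` separates `I` from the rest. A component inside attaches only to `S ∩ I` and `L`, giving
  -- `20 * k ^ 2 + 2 * k`; one outside is handled by induction in `H - I`.
  by_cases hvI : v ∈ I
  · have hsub : H.attachment (S ∪ R' \ I : Finset V) v ⊆ (S ∩ I ∪ L : Finset V) := by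
      rintro y ⟨hy, x, hx, hxy⟩
      have hxI : x ∈ I := mem_of_reachable_isolate (A := I) hx hvI fun x hx y hy a => by
        rcases Finset.mem_union.1 (hadj x hx y a) with h | h
        · exact h
        · exact absurd (hLI y h) hy
      have := hadj x hxI y hxy
      simp only [Finset.coe_union, Finset.coe_sdiff, Finset.coe_inter, Set.mem_union,
        Finset.mem_coe, Set.mem_sdiff, Set.mem_inter_iff, Finset.mem_union] at hy this ⊢
      tauto
    refine (Set.encard_le_encard hsub).trans ?_
    rw [Set.encard_coe_eq_coe_finsetCard]
    have := Finset.card_union_le (S ∩ I) L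
    exact Nat.cast_le.2 (by nlinarith)
  · have hvR : v ∉ R' := fun h =>
      hv (Finset.mem_union_right _ (Finset.mem_sdiff.2 ⟨h, hvI⟩))
    refine (Set.encard_le_encard ?_).trans (hR v hvR)
    have hIout : ∀ x ∉ I, x ∉ S ∪ R' \ I → ∀ y, H.Adj x y → y ∉ I := by
      intro x hx hxR y a hy
      rcases Finset.mem_union.1 (hadj y hy x a.symm) with h | h
      · exact hx h
      · exact hxR (hLI x h)
    rintro y ⟨hy, x, hx, hxy⟩
    obtain ⟨hx', hxI, hxR⟩ := reachable_of_closed (K := (H.isolate I).isolate R')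
      (A := {x | x ∉ I ∧ x ∉ S ∪ R' \ I}) hx ⟨hvI, hv⟩ fun x hx y a => by
        have hyI := hIout x hx.1 hx.2 y a.1
        have hR : ∀ z, z ∉ I → z ∉ S ∪ R' \ I → z ∉ R' := fun z h1 h2 h =>
          h2 (Finset.mem_union_right _ (Finset.mem_sdiff.2 ⟨h, h1⟩))
        exact ⟨⟨⟨a.1, hx.1, hyI⟩, hR x hx.1 hx.2, hR y hyI a.2.2⟩, hyI, a.2.2⟩
    have hyI := hIout x hxI hxR y hxy
    refine ⟨?_, x, hx', hxy, hxI, hyI⟩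
    rcases Finset.mem_union.1 hy with h | h
    · exact hSIR (Finset.mem_sdiff.2 ⟨h, hyI⟩)
    · exact (Finset.mem_sdiff.1 h).1

end SimpleGraph

/-! ### Expansions and the exhaustion -/

namespace SimpleGraph

variable {V : Type u} {G : SimpleGraph V} {k : ℕ}

/-- Shortest paths to the centre stay in the ball, so the subgraph it induces has radius at most
`r`. -/
lemma encard_closedBall_le_growth (G : SimpleGraph V) (v : V) (r : ℕ) :
    (G.closedBall v r).encard ≤ G.growth r := by
  set B := (⊤ : G.Subgraph).induce (G.closedBall v r) with hB
  have hdist : ∀ n ≤ r, ∀ w : B.verts, (w : V) ∈ G.closedBall v n →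
      B.coe.edist ⟨v, mem_closedBall_self v r⟩ w ≤ n := by
    intro n
    induction n with
    | zero =>
      rintro - ⟨w, hw⟩ (rfl : w = v)
      simp
    | succ n ih =>
      rintro hn ⟨w, hw⟩ (h | ⟨u, hu, huw⟩)
      · exact (ih (by omega) ⟨w, hw⟩ h).trans (by exact_mod_cast n.le_succ)
      · have hur : u ∈ G.closedBall v r := closedBall_mono v (by omega) hu
        refine (SimpleGraph.edist_triangle (v := ⟨u, hur⟩)).trans ?_
        push_cast
        refine add_le_add (ih (by omega) ⟨u, hur⟩ hu) (le_of_eq ?_)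
        rw [SimpleGraph.edist_eq_one_iff_adj]
        simpa [hB, huw, hur] using hw
  have hrad : B.coe.radius ≤ (r : ℕ∞) :=
    (iInf_le _ _).trans ((eccent_le_iff _ _).2 fun w => hdist r le_rfl w w.2)
  exact le_iSup₂_of_le (f := fun (H : G.Subgraph) (_ : H.coe.radius ≤ (r : ℕ∞)) => H.verts.encard)
    B hrad le_rfl

lemma ballBound_of_growth {c : ℝ}
    (hG : ∀ r : ℕ, 1 ≤ r → (G.growth r : ENNReal) ≤ ENNReal.ofReal (c * r)) :
    G.BallBound ⌈c⌉₊ := by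
  intro v r hr
  have h1 : (((G.closedBall v r).encard : ℕ∞) : ENNReal) ≤ ((⌈c⌉₊ * r : ℕ) : ENNReal) :=
    calc _ ≤ (G.growth r : ENNReal) := ENat.toENNReal_le.2 (G.encard_closedBall_le_growth v r)
      _ ≤ ENNReal.ofReal (c * r) := hG r hr
      _ ≤ ENNReal.ofReal ((⌈c⌉₊ * r : ℕ) : ℝ) := by
        apply ENNReal.ofReal_le_ofReal
        push_cast
        exact mul_le_mul_of_nonneg_right (Nat.le_ceil c) (Nat.cast_nonneg r)
      _ = _ := ENNReal.ofReal_natCast _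
  rw [← ENat.toENNReal_coe] at h1
  exact ENat.toENNReal_le.1 h1

/-- Every component of `G - R` has at most `M` vertices with a neighbour in `R`. -/
def FrontierBound (G : SimpleGraph V) (M : ℕ) (R : Set V) : Prop :=
  ∀ v, {w | w ∉ R ∧ (G.isolate R).Reachable v w ∧ ∃ y ∈ R, G.Adj y w}.encard ≤ M

/-- `R'` contains `R` and its neighbours, and at most `K` vertices of every component of
`G - R`. -/
structure IsExpansion (G : SimpleGraph V) (K : ℕ) (R R' : Set V) : Prop where
  subset : R ⊆ R'
  neighbor_mem : ∀ x ∈ R, ∀ y, G.Adj x y → y ∈ R'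
  encard_le : ∀ v, {w | w ∈ R' ∧ w ∉ R ∧ (G.isolate R).Reachable v w}.encard ≤ K

/-- In each component the frontier is enlarged to a `Q` of at most twice its size. A new component
attaches to at most `22 * k ^ 2` vertices of `Q`, each of degree at most `k`, which restores the
frontier bound. -/
theorem BallBound.exists_isExpansion (hk : 1 ≤ k) (hG : G.BallBound k) {R : Set V}
    (hR : G.FrontierBound (22 * k ^ 3) R) :
    ∃ R', G.IsExpansion (44 * k ^ 3) R R' ∧ G.FrontierBound (22 * k ^ 3) R' := by
  have hstep : ∀ C : (G.isolate R).ConnectedComponent, ∃ Q : Finset V,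
      (∀ w ∉ R, (G.isolate R).connectedComponentMk w = C → (∃ y ∈ R, G.Adj y w) → w ∈ Q) ∧
      Q.card ≤ 44 * k ^ 3 ∧
      ∀ v ∉ Q, ((G.isolate R).attachment Q v).encard ≤ (22 * k ^ 2 : ℕ) := by
    intro C
    induction C using ConnectedComponent.ind with
    | _ v =>
    obtain ⟨hfin, hle⟩ := Set.encard_le_coe_iff_finite_ncard_le.1 (hR v)
    obtain ⟨Q, h1, h2, h3⟩ := (hG.mono (G.isolate_le R)).exists_attachment_le hk hfin.toFinset
    rw [Set.ncard_eq_toFinset_card _ hfin] at hle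
    refine ⟨Q, fun w hw hC hy => h1 ?_, by omega, h3⟩
    rw [Set.Finite.mem_toFinset]
    exact ⟨hw, (ConnectedComponent.exact hC).symm, hy⟩
  choose Q hQ hQc hQa using hstep
  set R' := R ∪ {w | w ∈ Q ((G.isolate R).connectedComponentMk w)} with hR'
  have hmem : ∀ w, w ∉ R → w ∈ R' → w ∈ Q ((G.isolate R).connectedComponentMk w) :=
    fun w h1 h2 => h2.resolve_left h1
  have hnb : ∀ x ∈ R, ∀ y, G.Adj x y → y ∈ R' := fun x hx y a => by
    by_cases hy : y ∈ R
    · exact Or.inl hy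
    · exact Or.inr (hQ _ y hy rfl ⟨x, hx, a⟩)
  refine ⟨R', ⟨Set.subset_union_left, hnb, fun v => ?_⟩, fun v => ?_⟩
  · have hsub : {w | w ∈ R' ∧ w ∉ R ∧ (G.isolate R).Reachable v w} ⊆
        Q ((G.isolate R).connectedComponentMk v) := by
      rintro w ⟨hw, hwR, hr⟩
      rw [ConnectedComponent.sound hr]
      exact hmem w hwR hw
    refine (Set.encard_le_encard hsub).trans ?_
    rw [Set.encard_coe_eq_coe_finsetCard]
    exact Nat.cast_le.2 (hQc _)
  · by_cases hv : v ∈ R'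
    · have : {w | w ∉ R' ∧ (G.isolate R').Reachable v w ∧ ∃ y ∈ R', G.Adj y w} = ∅ := by
        rw [Set.eq_empty_iff_forall_notMem]
        rintro w ⟨hw, hr, -⟩
        exact hw (Reachable.mem_of_closed (H := G.isolate R') (fun x hx y a => absurd hx a.2.1) hr hv)
      rw [this]
      simp
    set C := (G.isolate R).connectedComponentMk v with hC
    have hvQ : v ∉ Q C := fun h => hv (Or.inr h)
    set Y := (G.isolate R).attachment (Q C) v with hY
    have hYfin : Y.Finite := (Q C).finite_toSet.subset fun y hy => hy.1
    have hsub : {w | w ∉ R' ∧ (G.isolate R').Reachable v w ∧ ∃ y ∈ R', G.Adj y w} ⊆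
        ⋃ y ∈ hYfin.toFinset, G.neighborSet y := by
      rintro w ⟨hw, hr, y, hy, hyw⟩
      obtain ⟨hr', hw'⟩ := reachable_of_closed (K := (G.isolate R).isolate (Q C))
        (A := {x | (G.isolate R).connectedComponentMk x = C}) hr rfl fun x hx z a => by
          have a' : (G.isolate R).Adj x z := isolate_anti G Set.subset_union_left a
          have hz : (G.isolate R).connectedComponentMk z = C :=
            (ConnectedComponent.sound a'.reachable).symm.trans hx
          refine ⟨⟨a', fun h => a.2.1 (Or.inr ?_), fun h => a.2.2 (Or.inr ?_)⟩, hz⟩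
          · rw [Set.mem_ofPred_eq, hx]; exact h
          · rw [Set.mem_ofPred_eq, hz]; exact h
      have hwR : w ∉ R := fun h => hw (Or.inl h)
      -- Neighbours of `R` were absorbed, so the new frontier only sees `Q C`.
      have hyR : y ∉ R := fun h => hw (hnb y h w hyw)
      have a : (G.isolate R).Adj w y := ⟨hyw.symm, hwR, hyR⟩
      have hyC : (G.isolate R).connectedComponentMk y = C :=
        (ConnectedComponent.sound a.reachable).symm.trans hw'
      have hyQ := hmem y hyR hy
      rw [hyC] at hyQ
      simp only [Set.mem_iUnion, Set.Finite.mem_toFinset]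
      exact ⟨y, ⟨hyQ, w, hr', a⟩, hyw⟩
    calc _ ≤ _ := Set.encard_le_encard hsub
      _ ≤ ∑ y ∈ hYfin.toFinset, (G.neighborSet y).encard := Finset.set_encard_biUnion_le _ _
      _ ≤ hYfin.toFinset.card • (k : ℕ∞) :=
        Finset.sum_le_card_nsmul _ _ _ fun y _ => hG.encard_neighborSet_le y
      _ ≤ (22 * k ^ 3 : ℕ) := by
        have := hQa C v hvQ
        rw [← hY, hYfin.encard_eq_coe_toFinset_card, Nat.cast_le] at this
        rw [nsmul_eq_mul, ← Nat.cast_mul, Nat.cast_le]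
        calc _ ≤ 22 * k ^ 2 * k := Nat.mul_le_mul_right _ this
          _ = _ := by ring

lemma isExpansion_empty_reps (hk : 1 ≤ k) :
    G.IsExpansion (44 * k ^ 3) ∅ (Set.range fun C : G.ConnectedComponent => C.out) where
  subset := Set.empty_subset _
  neighbor_mem _ h := absurd h (Set.notMem_empty _)
  encard_le v := by
    have hsub : {w | w ∈ (Set.range fun C : G.ConnectedComponent => C.out) ∧ w ∉ (∅ : Set V) ∧
        (G.isolate ∅).Reachable v w} ⊆ {(G.connectedComponentMk v).out} := by
      rintro _ ⟨⟨C, rfl⟩, -, hr⟩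
      have h1 := ConnectedComponent.sound (hr.mono (isolate_le _ _))
      have h2 : G.connectedComponentMk C.out = C := Quot.out_eq C
      rw [h1, h2]
      rfl
    refine (Set.encard_le_encard hsub).trans ?_
    rw [Set.encard_singleton]
    have : 1 ≤ k ^ 3 := Nat.one_le_pow _ _ hk
    exact_mod_cast (by omega : 1 ≤ 44 * k ^ 3)

/-- Within one component, the frontier consists of neighbours of its single representative. -/
lemma BallBound.frontierBound_reps (hk : 1 ≤ k) (hG : G.BallBound k) :
    G.FrontierBound (22 * k ^ 3) (Set.range fun C : G.ConnectedComponent => C.out) := by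
  intro v
  refine (Set.encard_le_encard (t := G.neighborSet (G.connectedComponentMk v).out) ?_).trans
    ((hG.encard_neighborSet_le _).trans (Nat.cast_le.2 ?_))
  · rintro w ⟨-, hr, _, ⟨C, rfl⟩, a⟩
    have h1 := ConnectedComponent.sound (hr.mono (isolate_le _ _))
    have h2 : G.connectedComponentMk C.out = C := Quot.out_eq C
    have h3 := ConnectedComponent.sound a.reachable
    dsimp only at h3
    rw [h1, ← h3, h2]
    exact a
  · calc k = 1 * k ^ 1 := by simp
      _ ≤ 22 * k ^ 3 := Nat.mul_le_mul (by norm_num) (Nat.pow_le_pow_right hk (by norm_num))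

/-- An exhaustion of `V` by successive expansions. -/
theorem BallBound.exists_exhaustion (hk : 1 ≤ k) (hG : G.BallBound k) :
    ∃ R : ℕ → Set V, R 0 = ∅ ∧ (∀ n, G.IsExpansion (44 * k ^ 3) (R n) (R (n + 1))) ∧
      ∀ v, ∃ n, v ∈ R n := by
  choose f hf hf' using fun R : {R : Set V // G.FrontierBound (22 * k ^ 3) R} =>
    hG.exists_isExpansion hk R.2
  let Q : ℕ → {R : Set V // G.FrontierBound (22 * k ^ 3) R} := fun n =>
    Nat.rec ⟨_, hG.frontierBound_reps hk⟩ (fun _ R => ⟨f R, hf' R⟩) n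
  have hQ : ∀ n, G.IsExpansion (44 * k ^ 3) (Q n).1 (Q (n + 1)).1 := fun n => hf (Q n)
  -- An empty set is prepended, so that the representatives are themselves absorbed at the first
  -- step.
  refine ⟨fun n => Nat.casesOn n ∅ fun n => (Q n).1, rfl, fun n => ?_, fun v => ?_⟩
  · cases n with
    | zero => exact isExpansion_empty_reps hk
    | succ n => exact hQ n
  · have hr : G.Reachable (G.connectedComponentMk v).out v :=
      ConnectedComponent.exact (Quot.out_eq (G.connectedComponentMk v))
    obtain ⟨n, hn⟩ := hr.mem_of_closed (A := {v | ∃ n, v ∈ (Q n).1})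
      (fun x ⟨n, hn⟩ y a => ⟨n + 1, (hQ n).neighbor_mem x hn y a⟩) ⟨0, _, rfl⟩
    exact ⟨n + 1, hn⟩

end SimpleGraph

/-! ### The tree of components -/

namespace SimpleGraph

section ParentTree

variable {W : Type u}

/-- The graph in which every vertex is joined to its parent. -/
def parentGraph (p : W → W) : SimpleGraph W := SimpleGraph.fromRel fun a b => p a = b

/-- Parents lead down to `r`, giving connectedness. Each edge from `v` to `p v` is a bridge: without
it, only descendants of `v` are reachable from `v`, and `p v` is too shallow to be one. -/
theorem isTree_parentGraph {p : W → W} {r : W} (depth : W → ℕ) (hr : p r = r)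
    (hp : ∀ w, w ≠ r → depth (p w) < depth w) : (parentGraph p).IsTree := by
  have hreach : ∀ w, (parentGraph p).Reachable r w := by
    intro w
    induction hn : depth w using Nat.strong_induction_on generalizing w with
    | _ n ih =>
    by_cases hw : w = r
    · rw [hw]
    · have hlt := hp w hw
      have hne : p w ≠ w := fun h => by rw [h] at hlt; exact lt_irrefl _ hlt
      have a : (parentGraph p).Adj (p w) w := (SimpleGraph.fromRel_adj _ _ _).2 ⟨hne, Or.inr rfl⟩
      exact (ih _ (hn ▸ hlt) _ rfl).trans a.reachable
  have hle : ∀ k w, depth (p^[k] w) ≤ depth w := by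
    intro k
    induction k with
    | zero => exact fun w => le_rfl
    | succ k ih =>
      intro w
      rw [Function.iterate_succ_apply]
      refine (ih _).trans ?_
      by_cases hw : w = r
      · rw [hw, hr]
      · exact (hp w hw).le
  have hbridge : ∀ v w, v ≠ w → p v = w → (parentGraph p).IsBridge s(v, w) := by
    intro v w hvw hpv
    rw [isBridge_iff]
    intro hreach
    have hvr : v ≠ r := by rintro rfl; exact hvw (hr.symm.trans hpv)
    obtain ⟨k, hk⟩ := hreach.mem_of_closed (A := {x | ∃ k, p^[k] x = v}) (by
      rintro x ⟨k, hk⟩ y a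
      rw [deleteEdges_adj] at a
      obtain ⟨a, hxy⟩ := a
      rcases ((SimpleGraph.fromRel_adj _ _ _).1 a).2 with h | h
      · cases k with
        | zero =>
          obtain rfl : x = v := hk
          exact absurd (by rw [← h, ← hpv]; rfl) hxy
        | succ k => exact ⟨k, by rw [← h]; exact hk⟩
      · exact ⟨k + 1, by rw [Function.iterate_succ_apply, h, hk]⟩) ⟨0, rfl⟩
    have h1 := hle k w
    have h2 := hp v hvr
    rw [hk] at h1
    rw [hpv] at h2
    omega
  have : Nonempty W := ⟨r⟩
  refine ⟨⟨fun a b => (hreach a).symm.trans (hreach b)⟩, ?_⟩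
  rw [isAcyclic_iff_forall_adj_isBridge]
  intro v w a
  obtain ⟨hne, h | h⟩ := (SimpleGraph.fromRel_adj _ _ _).1 a
  · exact hbridge v w hne h
  · rw [Sym2.eq_swap]
    exact hbridge w v hne.symm h

end ParentTree

variable {V : Type u} {G : SimpleGraph V}

/-- A map with fibres of size at most `m` that sends edges to vertices or edges gives an embedding
into the strong product with a complete graph. -/
theorem isContained_strongProduct_top {W : Type v} {T : SimpleGraph W} {m : ℕ} (f : V → W)
    (hf : ∀ x y, G.Adj x y → f x = f y ∨ T.Adj (f x) (f y))
    (hm : ∀ w, {x | f x = w}.encard ≤ m) :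
    G.IsContained (T.strongProduct (⊤ : SimpleGraph (Fin m))) := by
  have he : ∀ w, ∃ e : {x | f x = w} → Fin m, Function.Injective e := by
    intro w
    obtain ⟨hfin, hle⟩ := Set.encard_le_coe_iff_finite_ncard_le.1 (hm w)
    have := hfin.fintype
    rw [← Nat.card_coe_set_eq, Nat.card_eq_fintype_card] at hle
    obtain ⟨e⟩ := Function.Embedding.nonempty_of_card_le
      (hle.trans_eq (Fintype.card_fin m).symm)
    exact ⟨e, e.injective⟩
  choose e he using he
  let g : V → W × Fin m := fun x => (f x, e (f x) ⟨x, rfl⟩)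
  have hg : Function.Injective g := by
    intro x y h
    have h1 : f y = f x := (congrArg Prod.fst h).symm
    have h3 : ∀ w (hw : f y = w), e (f y) ⟨y, rfl⟩ = e w ⟨y, hw⟩ := by rintro _ rfl; rfl
    have h2 : e (f x) ⟨x, rfl⟩ = e (f x) ⟨y, h1⟩ := (congrArg Prod.snd h).trans (h3 _ h1)
    exact congrArg Subtype.val (he _ h2)
  refine ⟨⟨⟨g, ?_⟩, hg⟩⟩
  intro x y a
  rcases hf x y a with h | h
  · exact Or.inr ⟨h, fun h' => a.ne (hg (Prod.ext h h'))⟩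
  · exact Or.inl ⟨h, em _⟩

/-- The decreasing sequence of graphs whose components are the nodes of the tree. -/
def levelGraph (G : SimpleGraph V) (R : ℕ → Set V) : ℕ → SimpleGraph V
  | 0 => ⊤
  | n + 1 => G.isolate (R n)

lemma levelGraph_succ_le {R : ℕ → Set V} (hR : ∀ n, R n ⊆ R (n + 1)) (n : ℕ) :
    G.levelGraph R (n + 1) ≤ G.levelGraph R n := by
  cases n with
  | zero => exact le_top
  | succ n => exact isolate_anti G (hR n)

/-- The parent of a component of a level graph is the component of the previous level graph
containing it. -/
def levelParent {R : ℕ → Set V} (hR : ∀ n, R n ⊆ R (n + 1)) :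
    (Σ n, (G.levelGraph R n).ConnectedComponent) → Σ n, (G.levelGraph R n).ConnectedComponent
  | ⟨0, C⟩ => ⟨0, C⟩
  | ⟨n + 1, C⟩ => ⟨n, C.map (Hom.ofLE (levelGraph_succ_le hR n))⟩

theorem exists_isTree_isContained [Nonempty V] {K : ℕ} {R : ℕ → Set V} (h0 : R 0 = ∅)
    (hR : ∀ n, G.IsExpansion K (R n) (R (n + 1))) (hex : ∀ v, ∃ n, v ∈ R n) :
    ∃ (W : Type u) (T : SimpleGraph W), T.IsTree ∧
      G.IsContained (T.strongProduct (⊤ : SimpleGraph (Fin K))) := by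
  classical
  have hsub := fun n => (hR n).subset
  have hmono : Monotone R := monotone_nat_of_le_succ hsub
  let p := levelParent (G := G) hsub
  obtain ⟨v₀⟩ := ‹Nonempty V›
  -- Level 0 is the complete graph on `V`: its single component is a root even when `G` is
  -- disconnected.
  have htree : (parentGraph p).IsTree := by
    refine isTree_parentGraph (r := ⟨0, (G.levelGraph R 0).connectedComponentMk v₀⟩) Sigma.fst rfl ?_
    rintro ⟨_ | n, C⟩ hw
    · refine absurd ?_ hw
      congr 1
      induction C using ConnectedComponent.ind with
      | _ v => exact ConnectedComponent.sound (preconnected_top v v₀)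
    · exact n.lt_succ_self
  have hlv : ∀ v, ∃ n, v ∈ R (n + 1) ∧ v ∉ R n := by
    intro v
    have hpos : Nat.find (hex v) ≠ 0 := fun h => by
      have := Nat.find_spec (hex v)
      rw [h, h0] at this
      exact this
    obtain ⟨n, hn⟩ := Nat.exists_eq_succ_of_ne_zero hpos
    refine ⟨n, ?_, Nat.find_min (hex v) (by omega)⟩
    have := Nat.find_spec (hex v)
    rwa [hn] at this
  choose l hl hl' using hlv
  let f : V → Σ n, (G.levelGraph R n).ConnectedComponent := fun v =>
    ⟨l v + 1, (G.levelGraph R (l v + 1)).connectedComponentMk v⟩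
  have hlle : ∀ v n, v ∈ R (n + 1) → l v ≤ n := fun v n h => by
    by_contra! hc
    exact hl' v (hmono hc h)
  -- Both ends lie in one component of `G - R (l x)`, and `y` is absorbed at most one step after
  -- `x`.
  have hle : ∀ x y, G.Adj x y → l x ≤ l y → f x = f y ∨ (parentGraph p).Adj (f x) (f y) := by
    intro x y a hxy
    have hadj : (G.levelGraph R (l x + 1)).Adj x y :=
      ⟨a, hl' x, fun h => hl' y (hmono hxy h)⟩
    have hyle : l y ≤ l x + 1 := hlle y _ ((hR _).neighbor_mem x (hl x) y a)
    rcases hyle.lt_or_eq with h | h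
    · left
      have h : l y = l x := by omega
      simp only [f]
      rw [h]
      congr 1
      exact ConnectedComponent.sound hadj.reachable
    · right
      refine (SimpleGraph.fromRel_adj _ _ _).2 ⟨fun h' => ?_, Or.inr ?_⟩
      · have := congrArg Sigma.fst h'
        simp only [f] at this
        omega
      · simp only [f, p]
        rw [h]
        simp only [levelParent]
        congr 1
        exact ConnectedComponent.sound hadj.reachable.symm
  refine ⟨_, parentGraph p, htree, isContained_strongProduct_top f ?_ ?_⟩
  · intro x y a
    rcases le_total (l x) (l y) with h | h
    · exact hle x y a h
    · exact (hle y x a.symm h).imp Eq.symm Adj.symm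
  · rintro ⟨n, C⟩
    rcases Set.eq_empty_or_nonempty {x | f x = ⟨n, C⟩} with h | ⟨v, hv⟩
    · rw [h]; simp
    refine (Set.encard_le_encard ?_).trans ((hR (l v)).encard_le v)
    intro x hx
    have hxv : f v = f x := hv.trans hx.symm
    have h1 : l x = l v := by
      have := congrArg Sigma.fst hxv
      simp only [f] at this
      omega
    refine ⟨h1 ▸ hl x, h1 ▸ hl' x, ?_⟩
    simp only [f] at hxv
    rw [h1] at hxv
    exact ConnectedComponent.exact (eq_of_heq (Sigma.mk.inj hxv).2)

end SimpleGraph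

theorem mainTheorem7 {V : Type u} (G : SimpleGraph V) (c : ℝ) (hc : 1 ≤ c)
    (hG : ∀ r : ℕ, 1 ≤ r → (G.growth r : ENNReal) ≤ ENNReal.ofReal (c * r)) :
    ∃ (W : Type u) (T : SimpleGraph W), T.IsTree ∧
      G.IsContained (T.strongProduct (⊤ : SimpleGraph (Fin ⌊882 * c ^ 3⌋₊))) := by
  rcases isEmpty_or_nonempty V with hV | hV
  -- An empty `V` provides no root, so a one-vertex tree is used.
  · exact ⟨PUnit, ⊥, SimpleGraph.IsTree.of_subsingleton,
      SimpleGraph.isContained_strongProduct_top isEmptyElim isEmptyElim fun w => by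
        simp [Set.eq_empty_of_isEmpty]⟩
  have hk : 1 ≤ ⌈c⌉₊ := Nat.one_le_ceil_iff.2 (by linarith)
  -- Since `c ≥ 1`, `⌈c⌉ ≤ 2 * c`, and `44 * 8 = 352 ≤ 882`.
  have hK : 44 * ⌈c⌉₊ ^ 3 ≤ ⌊882 * c ^ 3⌋₊ := by
    apply Nat.le_floor
    have h1 : (⌈c⌉₊ : ℝ) ≤ 2 * c := by
      have := Nat.ceil_lt_add_one (by linarith : 0 ≤ c)
      linarith
    have h2 := pow_le_pow_left₀ (Nat.cast_nonneg _) h1 3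
    have h3 : 0 ≤ c ^ 3 := by positivity
    push_cast
    nlinarith
  obtain ⟨R, h0, hR, hex⟩ := (SimpleGraph.ballBound_of_growth hG).exists_exhaustion hk
  exact SimpleGraph.exists_isTree_isContained h0 (fun n => ⟨(hR n).subset, (hR n).neighbor_mem,
    fun v => ((hR n).encard_le v).trans (Nat.cast_le.2 hK)⟩) hex
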